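/- Let $I\subset\mathbb{R}$ be a finite (that is, bounded) interval with more than one point, and let $n\ge 1$ and $m\ge 2n$ be integers. Then there is a real polynomial $f_m$ of degree exactly $m$ which, as a function on $I$, is both strictly $n$-concave and strictly $n$-monotone. Likewise, there is a real polynomial $g_m$ of degree exactly $m$ which, as a function on $I$, is both strictly $n$-convex and strictly $n$-monotone. Here a function $f\colon I\to\mathbb{R}$ is called $n$-monotone if $A\le B$ implies $f(A)\le f(B)$, and $n$-convex if $$f(\lambda A+(1-\lambda)B)\le \lambda f(A)+(1-\lambda)f(B)\qquad(\lambda\in[0,1]),$$ for all Hermitian $n\times n$ matrices $A,B$ with spectra in $I$, where $X\le Y$ means that $Y-X$ is positive semidefinite and $f(A)$ is defined by the functional calculus. It is strictly $n$-monotone if it is $n$-monotone, $2n-1$ times continuously differentiable, and $$\det\left(\frac{f^{(i+j-1)}(t)}{(i+j-1)!}\right)_{i,j=1}^n>0\qquad\text{for every } t\in I;$$ it is strictly $n$-convex if it is $n$-convex, $2n$ times continuously differentiable, and $$\det\left(\frac{f^{(i+j)}(t)}{(i+j)!}\right)_{i,j=1}^n>0\qquad\text{for every } t\in I;$$ and it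 is strictly $n$-concave if $-f$ is strictly $n$-convex. At an endpoint belonging to $I$, derivatives are one-sided. -/

import Mathlib

open scoped ComplexOrder

noncomputable section

/-- A real function `f` is `n`-monotone on the interval `I` if `A ≤ B` implies `f(A) ≤ f(B)` for
all Hermitian complex `n × n` matrices `A`, `B` with spectra in `I`. Here `A ≤ B` is the Loewner
order (`B - A` is positive semidefinite) and `f(A) = cfc f A` is the functional calculus. Only the
values of `f` on `I` matter. -/
def NMonotoneOn (n : ℕ) (f : ℝ → ℝ) (I : Set ℝ) : Prop :=
  ∀ A B : Matrix (Fin n) (Fin n) ℂ, A.IsHermitian → B.IsHermitian →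
    spectrum ℝ A ⊆ I → spectrum ℝ B ⊆ I →
    (B - A).PosSemidef → (cfc f B - cfc f A).PosSemidef

/-- A real function `f` is `n`-convex on the interval `I` if
`f(λ A + (1 - λ) B) ≤ λ f(A) + (1 - λ) f(B)` for all `λ ∈ [0, 1]` and all Hermitian complex
`n × n` matrices `A`, `B` with spectra in `I`. -/
def NConvexOn (n : ℕ) (f : ℝ → ℝ) (I : Set ℝ) : Prop :=
  ∀ A B : Matrix (Fin n) (Fin n) ℂ, A.IsHermitian → B.IsHermitian →
    spectrum ℝ A ⊆ I → spectrum ℝ B ⊆ I → ∀ c : ℝ, c ∈ Set.Icc (0 : ℝ) 1 →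
    (c • cfc f A + (1 - c) • cfc f B - cfc f (c • A + (1 - c) • B)).PosSemidef

/-- The matrix `(f^{(i+j-1)}(t) / (i+j-1)!)` with `i, j = 1, …, n`. The row and column indices in
`Fin n` start at `0`, so `i + j - 1` becomes `i + j + 1`. Derivatives are taken within `I`: on an
open interval they are the usual ones, at an endpoint that belongs to `I` they are one-sided. -/
def monotoneHankel (n : ℕ) (f : ℝ → ℝ) (I : Set ℝ) (t : ℝ) : Matrix (Fin n) (Fin n) ℝ :=
  Matrix.of fun i j =>
    iteratedDerivWithin ((i : ℕ) + j + 1) f I t / (Nat.factorial ((i : ℕ) + j + 1) : ℝ)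

/-- The matrix `(f^{(i+j)}(t) / (i+j)!)` with `i, j = 1, …, n`, with indices in `Fin n` again
starting at `0`, so that `i + j` becomes `i + j + 2`. -/
def convexHankel (n : ℕ) (f : ℝ → ℝ) (I : Set ℝ) (t : ℝ) : Matrix (Fin n) (Fin n) ℝ :=
  Matrix.of fun i j =>
    iteratedDerivWithin ((i : ℕ) + j + 2) f I t / (Nat.factorial ((i : ℕ) + j + 2) : ℝ)

/-- Strict `n`-monotonicity (for `n ≥ 1`): `f` is `n`-monotone, of class `C^{2n-1}`, and the
determinant of `(f^{(i+j-1)}(t) / (i+j-1)!)` is positive at every point of `I`. -/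
def StrictNMonotoneOn (n : ℕ) (f : ℝ → ℝ) (I : Set ℝ) : Prop :=
  NMonotoneOn n f I ∧ ContDiffOn ℝ ((2 * n - 1 : ℕ) : ℕ∞) f I ∧
    ∀ t ∈ I, 0 < (monotoneHankel n f I t).det

/-- Strict `n`-convexity: `f` is `n`-convex, of class `C^{2n}`, and the determinant of
`(f^{(i+j)}(t) / (i+j)!)` is positive at every point of `I`. -/
def StrictNConvexOn (n : ℕ) (f : ℝ → ℝ) (I : Set ℝ) : Prop :=
  NConvexOn n f I ∧ ContDiffOn ℝ ((2 * n : ℕ) : ℕ∞) f I ∧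
    ∀ t ∈ I, 0 < (convexHankel n f I t).det

/-- `f` is strictly `n`-concave if `-f` is strictly `n`-convex. -/
def StrictNConcaveOn (n : ℕ) (f : ℝ → ℝ) (I : Set ℝ) : Prop :=
  StrictNConvexOn n (fun t => -f t) I

end

/-! Take the polynomial `p` of degree `m` whose coefficients `b k` (`k ≥ 1`) are moments `∑ s_a ^ (k
- 1)` of `n` distinct points `s_a = σ (a + 1)`, where `σ = ±1`. The Hankel matrix of `b (i + j + 1)`
is then positive definite, and so is that of `σ * b (i + j + 2)`, a moment matrix with weights `σ
s_a = a + 1 > 0`. Hence near `0` the polynomial `p` should be monotone and `σ p` convex. The answer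
is `p (δ t)`, with `δ` so small that `δ I` lies near `0`; `σ = -1` gives the concave case and `σ =
1` the convex one.

For matrices of small norm this is proved directly. The derivative of `⟪ξ, p(T) ξ⟫` in a direction
`C* C` is a sum of `b (i + l + 1) ⟪v i, v l⟫` with `v k = C T ^ k ξ`. By Cayley–Hamilton, `T ^ n` is
a combination of lower powers with coefficients of order `‖T‖`, so every `v k` with `k ≥ n` is small
compared with `v 0, …, v (n - 1)`. The block `i, l < n` is positive definite by Vandermonde
invertibility and dominates the rest (`sum_form_nonneg`). The condition `2 * n ≤ m` ensures that
truncation at degree `m` leaves this block intact. The second derivative is similar: its extra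
middle factor `T ^ j` is negligible for `j ≥ 1`.

The determinants are positive at `0` by the same moment factorization, and near `0` by continuity.
-/

/-! ### Moment forms on finite families of vectors. -/

/-- The inverse Vandermonde matrix recovers the `v i` from the sums on the right; `κ` depends only
on its entries and on `n`. -/
theorem exists_sq_sum_norm_le_vandermonde (E : Type*) [NormedAddCommGroup E] [NormedSpace ℝ E]
    {n : ℕ} {s : Fin n → ℝ} (hs : Function.Injective s) :
    ∃ κ : ℝ, 0 < κ ∧ ∀ v : Fin n → E,
      κ * (∑ i, ‖v i‖) ^ 2 ≤ ∑ a, ‖∑ i : Fin n, s a ^ (i : ℕ) • v i‖ ^ 2 := by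
  set V := Matrix.vandermonde s
  have hdet : IsUnit V.det := (Matrix.det_vandermonde_ne_zero_iff.mpr hs).isUnit
  set W := V⁻¹
  have hWV : W * V = 1 := Matrix.nonsing_inv_mul V hdet
  set K : ℝ := 1 + ∑ i, ∑ a, |W i a| with hK
  have hK0 : 0 < K := by positivity
  -- The factor `n` comes from Cauchy–Schwarz; `n + 1` keeps the constant positive for `n = 0`.
  refine ⟨(K ^ 2 * (n + 1))⁻¹, by positivity, fun v => ?_⟩
  set y : Fin n → E := fun a => ∑ i : Fin n, s a ^ (i : ℕ) • v i with hy
  have hv : ∀ i, v i = ∑ a, W i a • y a := by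
    intro i
    have h1 : ∀ j : Fin n, ∑ a, W i a * s a ^ (j : ℕ) = (1 : Matrix (Fin n) (Fin n) ℝ) i j := by
      intro j
      rw [← hWV, Matrix.mul_apply]
      rfl
    simp only [hy, Finset.smul_sum, smul_smul]
    rw [Finset.sum_comm]
    simp only [← Finset.sum_smul, h1]
    simp [Matrix.one_apply]
  have hYnn : 0 ≤ ∑ a, ‖y a‖ := Finset.sum_nonneg fun _ _ => norm_nonneg _
  have hS : ∑ i, ‖v i‖ ≤ K * ∑ a, ‖y a‖ := by
    calc ∑ i, ‖v i‖ ≤ ∑ i, ∑ a, |W i a| * ∑ a, ‖y a‖ := by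
          refine Finset.sum_le_sum fun i _ => ?_
          rw [hv i]
          refine (norm_sum_le _ _).trans (Finset.sum_le_sum fun a _ => ?_)
          rw [norm_smul, Real.norm_eq_abs]
          exact mul_le_mul_of_nonneg_left
            (Finset.single_le_sum (f := fun a => ‖y a‖) (fun _ _ => norm_nonneg _)
              (Finset.mem_univ a)) (abs_nonneg _)
      _ = (∑ i, ∑ a, |W i a|) * ∑ a, ‖y a‖ := by simp only [Finset.sum_mul]
      _ ≤ K * ∑ a, ‖y a‖ := by
          refine mul_le_mul_of_nonneg_right ?_ hYnn
          rw [hK]; linarith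
  have hY2 : (∑ a, ‖y a‖) ^ 2 ≤ n * ∑ a, ‖y a‖ ^ 2 := by
    simpa using sq_sum_le_card_mul_sum_sq (s := Finset.univ) (f := fun a => ‖y a‖)
  have hYY : 0 ≤ ∑ a, ‖y a‖ ^ 2 := by positivity
  have hS0 : 0 ≤ ∑ i, ‖v i‖ := by positivity
  rw [inv_mul_le_iff₀ (by positivity)]
  calc (∑ i, ‖v i‖) ^ 2 ≤ (K * ∑ a, ‖y a‖) ^ 2 := by gcongr
    _ = K ^ 2 * (∑ a, ‖y a‖) ^ 2 := by ring
    _ ≤ K ^ 2 * (n * ∑ a, ‖y a‖ ^ 2) := by gcongr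
    _ ≤ K ^ 2 * (n + 1) * ∑ a, ‖y a‖ ^ 2 := by nlinarith [mul_nonneg (sq_nonneg K) hYY]

theorem sum_vandermonde_weight_mul_re_inner {E : Type*} [NormedAddCommGroup E]
    [InnerProductSpace ℂ E] {n : ℕ} (s w : Fin n → ℝ) (v : Fin n → E) :
    ∑ i : Fin n, ∑ l : Fin n, (∑ a, w a * s a ^ ((i : ℕ) + l)) * (inner ℂ (v i) (v l)).re =
      ∑ a, w a * ‖∑ i : Fin n, s a ^ (i : ℕ) • v i‖ ^ 2 := by
  have h : ∀ a, ‖∑ i : Fin n, s a ^ (i : ℕ) • v i‖ ^ 2 =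
      ∑ i : Fin n, ∑ l : Fin n, s a ^ ((i : ℕ) + l) * (inner ℂ (v i) (v l)).re := by
    intro a
    rw [← inner_self_eq_norm_sq (𝕜 := ℂ)]
    simp only [sum_inner, inner_sum, ← Complex.coe_smul, inner_smul_left, inner_smul_right,
      RCLike.re_to_complex, Complex.re_sum, Complex.conj_ofReal, Complex.re_ofReal_mul, pow_add,
      mul_assoc, Finset.mul_sum]
    rw [Finset.sum_comm]
    exact Finset.sum_congr rfl fun i _ => Finset.sum_congr rfl fun l _ => by ring
  simp only [h, Finset.sum_mul, Finset.mul_sum]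
  symm
  rw [Finset.sum_comm]
  refine Finset.sum_congr rfl fun i _ => ?_
  rw [Finset.sum_comm]
  simp only [mul_assoc]

/-- Applied to `v k = C T ^ k ξ`, with the recurrence coming from Cayley–Hamilton. -/
theorem norm_le_of_linear_recurrence {E : Type*} [NormedAddCommGroup E] [NormedSpace ℂ E]
    {n : ℕ} {v : ℕ → E} {c : ℕ → ℂ} {η : ℝ} (hη : n * η ≤ 1)
    (hc : ∀ j < n, ‖c j‖ ≤ η)
    (hv : ∀ k, v (k + n) = -∑ j ∈ Finset.range n, c j • v (k + j)) (k : ℕ) :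
    ‖v k‖ ≤ ∑ i : Fin n, ‖v i‖ ∧ (n ≤ k → ‖v k‖ ≤ n * η * ∑ i : Fin n, ‖v i‖) := by
  set S := ∑ i : Fin n, ‖v i‖
  have hS : 0 ≤ S := by positivity
  induction k using Nat.strong_induction_on with
  | _ k ih =>
    by_cases hk : k < n
    · exact ⟨Finset.single_le_sum (f := fun i : Fin n => ‖v i‖) (fun _ _ => norm_nonneg _)
        (Finset.mem_univ ⟨k, hk⟩), fun h => by omega⟩
    · obtain ⟨r, rfl⟩ := Nat.exists_eq_add_of_le' (not_lt.mp hk)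
      have h2 : ‖v (r + n)‖ ≤ n * η * S := by
        rw [hv, norm_neg]
        refine (norm_sum_le _ _).trans ?_
        calc ∑ j ∈ Finset.range n, ‖c j • v (r + j)‖ ≤ ∑ j ∈ Finset.range n, η * S := by
              refine Finset.sum_le_sum fun j hj => ?_
              rw [Finset.mem_range] at hj
              rw [norm_smul]
              exact mul_le_mul (hc j hj) (ih (r + j) (by omega)).1 (norm_nonneg _)
                ((norm_nonneg _).trans (hc j hj))
          _ = n * η * S := by simp [mul_assoc]
      exact ⟨h2.trans (mul_le_of_le_one_left hS hη), fun _ => h2⟩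

theorem sum_range_range_ite {n m : ℕ} (hnm : n ≤ m) (f : ℕ → ℕ → ℝ) :
    ∑ i ∈ Finset.range m, ∑ l ∈ Finset.range m, (if i < n ∧ l < n then f i l else 0) =
      ∑ i : Fin n, ∑ l : Fin n, f i l := by
  have hsub : (Finset.range m).filter (· < n) = Finset.range n := by
    ext; simp only [Finset.mem_filter, Finset.mem_range]; omega
  rw [← Finset.sum_range (fun i => ∑ l : Fin n, f i l), ← hsub, Finset.sum_filter]
  refine Finset.sum_congr rfl fun i _ => ?_
  by_cases hi : i < n
  · simp only [hi, true_and, if_true]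
    rw [← Finset.sum_range (fun l => f i l), ← hsub, Finset.sum_filter]
  · simp [hi]

/-- The block `i, l < n` contributes at least `(κ - δ) S ^ 2`, where `S` is the sum of the first `n`
norms. Each remaining entry involves an index `≥ n` and so costs at most `B η S ^ 2`. -/
theorem sum_form_nonneg {E : Type*} [NormedAddCommGroup E] [InnerProductSpace ℂ E]
    {n m : ℕ} (hnm : n ≤ m) {s w : Fin n → ℝ} (hw : ∀ a, 1 ≤ w a) {κ : ℝ}
    (hκ : ∀ v : Fin n → E, κ * (∑ i, ‖v i‖) ^ 2 ≤ ∑ a, ‖∑ i : Fin n, s a ^ (i : ℕ) • v i‖ ^ 2)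
    {v : ℕ → E} {F : ℕ → ℕ → ℝ} {B δ η : ℝ} (hB : 0 ≤ B) (hη : 0 ≤ η)
    (hF : ∀ i l, |F i l| ≤ B * (‖v i‖ * ‖v l‖))
    (hFn : ∀ i < n, ∀ l < n, (∑ a, w a * s a ^ (i + l)) * (inner ℂ (v i) (v l)).re -
      δ * (‖v i‖ * ‖v l‖) ≤ F i l)
    (hv : ∀ k, ‖v k‖ ≤ ∑ i : Fin n, ‖v i‖)
    (hv' : ∀ k, n ≤ k → ‖v k‖ ≤ η * ∑ i : Fin n, ‖v i‖)
    (hsmall : δ + m ^ 2 * (B * η) ≤ κ) :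
    0 ≤ ∑ i ∈ Finset.range m, ∑ l ∈ Finset.range m, F i l := by
  set S := ∑ i : Fin n, ‖v i‖ with hS
  have hS0 : 0 ≤ S := by positivity
  set P : ℕ → ℕ → ℝ := fun i l => (∑ a, w a * s a ^ (i + l)) * (inner ℂ (v i) (v l)).re -
      δ * (‖v i‖ * ‖v l‖) with hP
  have hlow : ∀ i l, (if i < n ∧ l < n then P i l else 0) - B * η * S ^ 2 ≤ F i l := by
    intro i l
    split_ifs with h
    · have := hFn i h.1 l h.2
      have h2 : 0 ≤ B * η * S ^ 2 := by positivity
      linarith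
    · have hprod : ‖v i‖ * ‖v l‖ ≤ η * S ^ 2 := by
        by_cases hi : i < n
        · have hl : n ≤ l := by by_contra hl; exact h ⟨hi, by omega⟩
          calc ‖v i‖ * ‖v l‖ ≤ S * (η * S) :=
                mul_le_mul (hv i) (hv' l hl) (norm_nonneg _) hS0
            _ = η * S ^ 2 := by ring
        · calc ‖v i‖ * ‖v l‖ ≤ (η * S) * S :=
                mul_le_mul (hv' i (by omega)) (hv l) (norm_nonneg _) (by positivity)
            _ = η * S ^ 2 := by ring
      have h1 := (abs_le.mp (hF i l)).1
      have h2 := mul_le_mul_of_nonneg_left hprod hB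
      linarith
  have hPsum : ∑ i : Fin n, ∑ l : Fin n, P i l =
      ∑ a, w a * ‖∑ i : Fin n, s a ^ (i : ℕ) • v i‖ ^ 2 - δ * S ^ 2 := by
    simp only [hP, Finset.sum_sub_distrib]
    rw [← sum_vandermonde_weight_mul_re_inner s w (fun i => v i)]
    congr 1
    simp only [← Finset.mul_sum, ← Finset.sum_mul, sq, hS]
  have hPge : κ * S ^ 2 - δ * S ^ 2 ≤ ∑ i : Fin n, ∑ l : Fin n, P i l := by
    rw [hPsum]
    gcongr
    refine (hκ fun i => v i).trans (Finset.sum_le_sum fun a _ => ?_)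
    exact le_mul_of_one_le_left (by positivity) (hw a)
  calc (0 : ℝ) ≤ (κ - δ - m ^ 2 * (B * η)) * S ^ 2 := mul_nonneg (by linarith) (by positivity)
    _ ≤ ∑ i : Fin n, ∑ l : Fin n, P i l - m ^ 2 * (B * η * S ^ 2) := by linarith
    _ = ∑ i ∈ Finset.range m, ∑ l ∈ Finset.range m,
          ((if i < n ∧ l < n then P i l else 0) - B * η * S ^ 2) := by
        simp only [Finset.sum_sub_distrib, sum_range_range_ite hnm P]
        simp; ring
    _ ≤ _ := Finset.sum_le_sum fun i _ => Finset.sum_le_sum fun l _ => hlow i l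

/-! ### Noncommutative derivatives of powers. -/

/-- Reindexing by `k = i + l + 1`, which turns a sum of derivatives of powers into a Hankel form. -/
theorem sum_range_sum_range_sub {M : Type*} [AddCommMonoid M] (N : ℕ) (g : ℕ → ℕ → M) :
    ∑ k ∈ Finset.range N, ∑ i ∈ Finset.range k, g i (k - 1 - i) =
      ∑ i ∈ Finset.range N, ∑ l ∈ Finset.range N, if i + l + 1 < N then g i l else 0 := by
  simp only [Finset.sum_sigma', ← Finset.sum_filter]
  refine Finset.sum_bij' (fun x _ => ⟨x.2, x.1 - 1 - x.2⟩) (fun x _ => ⟨x.1 + x.2 + 1, x.1⟩)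
    ?_ ?_ ?_ ?_ ?_
  · rintro ⟨k, i⟩ h
    simp only [Finset.mem_sigma, Finset.mem_range, Finset.mem_filter] at h ⊢
    omega
  · rintro ⟨i, l⟩ h
    simp only [Finset.mem_sigma, Finset.mem_range, Finset.mem_filter] at h ⊢
    omega
  · rintro ⟨k, i⟩ h
    simp only [Finset.mem_sigma, Finset.mem_range] at h
    have : i + (k - 1 - i) + 1 = k := by omega
    simp [this]
  · rintro ⟨i, l⟩ h
    have : i + l - i = l := by omega
    simp [this]
  · rintro ⟨k, i⟩ h
    rfl

/-- The derivative of `X ↦ X ^ k` at `T` in direction `D`. -/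
def powDeriv {R : Type*} [Ring R] (T D : R) (k : ℕ) : R :=
  ∑ i ∈ Finset.range k, T ^ i * D * T ^ (k - 1 - i)

/-- Half the second derivative of `X ↦ X ^ k` at `T` in direction `D`. -/
def powDeriv₂ {R : Type*} [Ring R] (T D : R) (k : ℕ) : R :=
  ∑ i ∈ Finset.range k, T ^ i * D * powDeriv T D (k - 1 - i)

theorem powDeriv_succ {R : Type*} [Ring R] (T D : R) (k : ℕ) :
    powDeriv T D (k + 1) = D * T ^ k + T * powDeriv T D k := by
  rw [powDeriv, Finset.sum_range_succ', powDeriv, Finset.mul_sum, add_comm]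
  congr 1
  · simp
  · refine Finset.sum_congr rfl fun i _ => ?_
    rw [pow_succ', show k + 1 - 1 - (i + 1) = k - 1 - i by omega]
    simp only [mul_assoc]

theorem powDeriv₂_succ {R : Type*} [Ring R] (T D : R) (k : ℕ) :
    powDeriv₂ T D (k + 1) = D * powDeriv T D k + T * powDeriv₂ T D k := by
  rw [powDeriv₂, Finset.sum_range_succ', powDeriv₂, Finset.mul_sum, add_comm]
  congr 1
  · simp
  · refine Finset.sum_congr rfl fun i _ => ?_
    rw [pow_succ', show k + 1 - 1 - (i + 1) = k - 1 - i by omega]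
    simp only [mul_assoc]

section Deriv

variable {R : Type*} [NormedRing R] [NormedAlgebra ℝ R]

theorem hasDerivAt_add_smul (A D : R) (t : ℝ) : HasDerivAt (fun t : ℝ => A + t • D) D t := by
  simpa using ((hasDerivAt_id t).smul_const D).const_add A

theorem hasDerivAt_add_smul_pow (A D : R) (k : ℕ) (t : ℝ) :
    HasDerivAt (fun t : ℝ => (A + t • D) ^ k) (powDeriv (A + t • D) D k) t := by
  induction k with
  | zero => simpa [powDeriv] using hasDerivAt_const t (1 : R)
  | succ k ih =>
    rw [powDeriv_succ]
    simp only [pow_succ' _ k]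
    exact (hasDerivAt_add_smul A D t).mul ih

theorem hasDerivAt_powDeriv (A D : R) (k : ℕ) (t : ℝ) :
    HasDerivAt (fun t : ℝ => powDeriv (A + t • D) D k)
      ((2 : ℝ) • powDeriv₂ (A + t • D) D k) t := by
  induction k with
  | zero => simpa [powDeriv, powDeriv₂] using hasDerivAt_const t (0 : R)
  | succ k ih =>
    simp only [powDeriv_succ, powDeriv₂_succ]
    refine (((hasDerivAt_add_smul_pow A D k t).const_mul D).add
      ((hasDerivAt_add_smul A D t).mul ih)).congr_deriv ?_
    simp only [two_smul, mul_add]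
    abel

end Deriv

/-! ### Positivity of the first and second derivative forms. -/

section Form

variable {E : Type*} [NormedAddCommGroup E] [InnerProductSpace ℂ E] [CompleteSpace E]

theorem inner_pow_left_of_isSelfAdjoint {T : E →L[ℂ] E} (hT : IsSelfAdjoint T) (k : ℕ) (x y : E) :
    inner ℂ x ((T ^ k) y) = inner ℂ ((T ^ k) x) y :=
  ((ContinuousLinearMap.isSelfAdjoint_iff_isSymmetric.mp (hT.pow k)) x y).symm

theorem sum_re_inner_powDeriv {T : E →L[ℂ] E} (hT : IsSelfAdjoint T) (C : E →L[ℂ] E) (b : ℕ → ℝ)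
    (N : ℕ) (ξ : E) :
    ∑ k ∈ Finset.range N,
        b k * (inner ℂ ξ (powDeriv T (ContinuousLinearMap.adjoint C * C) k ξ)).re =
      ∑ i ∈ Finset.range N, ∑ l ∈ Finset.range N, if i + l + 1 < N then
        b (i + l + 1) * (inner ℂ (C ((T ^ i) ξ)) (C ((T ^ l) ξ))).re else 0 := by
  rw [← sum_range_sum_range_sub N
    (fun i l => b (i + l + 1) * (inner ℂ (C ((T ^ i) ξ)) (C ((T ^ l) ξ))).re)]
  refine Finset.sum_congr rfl fun k _ => ?_
  rw [powDeriv, sum_apply, inner_sum, Complex.re_sum, Finset.mul_sum]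
  refine Finset.sum_congr rfl fun i hi => ?_
  rw [Finset.mem_range] at hi
  rw [show i + (k - 1 - i) + 1 = k by omega]
  simp only [mul_apply_eq_comp]
  rw [inner_pow_left_of_isSelfAdjoint hT, ContinuousLinearMap.adjoint_inner_right]

theorem sum_re_inner_powDeriv₂ {T D : E →L[ℂ] E} (hT : IsSelfAdjoint T) (hD : IsSelfAdjoint D)
    (b : ℕ → ℝ) (N : ℕ) (ξ : E) :
    ∑ k ∈ Finset.range N, b k * (inner ℂ ξ (powDeriv₂ T D k ξ)).re =
      ∑ i ∈ Finset.range N, ∑ l ∈ Finset.range N, ∑ j ∈ Finset.range N,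
        if i + j + l + 2 < N then b (i + j + l + 2) *
          (inner ℂ (D ((T ^ i) ξ)) ((T ^ j) (D ((T ^ l) ξ)))).re else 0 := by
  have hDs : ∀ x y, inner ℂ x (D y) = inner ℂ (D x) y := fun x y =>
    ((ContinuousLinearMap.isSelfAdjoint_iff_isSymmetric.mp hD) x y).symm
  have h1 : ∀ k, b k * (inner ℂ ξ (powDeriv₂ T D k ξ)).re = ∑ i ∈ Finset.range k,
      b (i + (k - 1 - i) + 1) *
        (inner ℂ (D ((T ^ i) ξ)) (powDeriv T D (k - 1 - i) ξ)).re := by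
    intro k
    rw [powDeriv₂, sum_apply, inner_sum, Complex.re_sum, Finset.mul_sum]
    refine Finset.sum_congr rfl fun i hi => ?_
    rw [Finset.mem_range] at hi
    rw [show i + (k - 1 - i) + 1 = k by omega]
    simp only [mul_apply_eq_comp]
    rw [inner_pow_left_of_isSelfAdjoint hT, hDs]
  simp only [h1]
  rw [sum_range_sum_range_sub N
    (fun i p => b (i + p + 1) * (inner ℂ (D ((T ^ i) ξ)) (powDeriv T D p ξ)).re)]
  refine Finset.sum_congr rfl fun i _ => ?_
  let G : ℕ → ℕ → ℝ := fun j l => if i + j + l + 2 < N then b (i + j + l + 2) *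
    (inner ℂ (D ((T ^ i) ξ)) ((T ^ j) (D ((T ^ l) ξ)))).re else 0
  have h2 : ∀ p, (if i + p + 1 < N then
      b (i + p + 1) * (inner ℂ (D ((T ^ i) ξ)) (powDeriv T D p ξ)).re else 0) =
      ∑ j ∈ Finset.range p, G j (p - 1 - j) := by
    intro p
    have h3 : ∀ j ∈ Finset.range p, G j (p - 1 - j) = if i + p + 1 < N then b (i + p + 1) *
        (inner ℂ (D ((T ^ i) ξ)) ((T ^ j) (D ((T ^ (p - 1 - j)) ξ)))).re else 0 := by
      intro j hj
      rw [Finset.mem_range] at hj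
      have h4 : i + j + (p - 1 - j) + 2 = i + p + 1 := by omega
      simp only [G, h4]
    rw [Finset.sum_congr rfl h3]
    split_ifs
    · rw [powDeriv, sum_apply, inner_sum, Complex.re_sum, Finset.mul_sum]
      rfl
    · exact Finset.sum_const_zero.symm
  rw [Finset.sum_congr rfl fun p _ => h2 p, sum_range_sum_range_sub N G, Finset.sum_comm]
  refine Finset.sum_congr rfl fun l _ => Finset.sum_congr rfl fun j _ => ?_
  by_cases h : i + j + l + 2 < N
  -- The bound `j + l + 1 < N` from the reindexing is implied by the bound on `i + j + l + 2`.
  · rw [if_pos (by omega)]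
  · simp only [G, if_neg h, ite_self]

theorem re_inner_powDeriv_sum_nonneg {n m : ℕ} (hnm : 2 * n ≤ m) {s w : Fin n → ℝ}
    (hw : ∀ a, 1 ≤ w a) {κ : ℝ}
    (hκ : ∀ v : Fin n → E, κ * (∑ i, ‖v i‖) ^ 2 ≤ ∑ a, ‖∑ i : Fin n, s a ^ (i : ℕ) • v i‖ ^ 2)
    {b : ℕ → ℝ} (hb : ∀ k, b (k + 1) = ∑ a, w a * s a ^ k) {B η : ℝ} (hB : 0 ≤ B)
    (hbB : ∀ k ≤ m, |b k| ≤ B) {T : E →L[ℂ] E} (hT : IsSelfAdjoint T) (C : E →L[ℂ] E)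
    {c : ℕ → ℂ} (hη : n * η ≤ 1) (hη0 : 0 ≤ η) (hc : ∀ j < n, ‖c j‖ ≤ η)
    (hTn : T ^ n = -∑ j ∈ Finset.range n, c j • T ^ j)
    (hsmall : ((m + 1 : ℕ) : ℝ) ^ 2 * (B * (n * η)) ≤ κ) (ξ : E) :
    0 ≤ ∑ k ∈ Finset.range (m + 1),
      b k * (inner ℂ ξ (powDeriv T (ContinuousLinearMap.adjoint C * C) k ξ)).re := by
  rw [sum_re_inner_powDeriv hT]
  have hrec : ∀ k, C ((T ^ (k + n)) ξ) =
      -∑ j ∈ Finset.range n, c j • C ((T ^ (k + j)) ξ) := by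
    intro k
    simp [pow_add, hTn]
  have hv := norm_le_of_linear_recurrence (v := fun k => C ((T ^ k) ξ)) hη hc hrec
  refine sum_form_nonneg (v := fun k => C ((T ^ k) ξ)) (by omega) hw hκ (B := B) (δ := 0)
    (η := n * η) hB (by positivity) ?_ ?_ (fun k => (hv k).1) (fun k => (hv k).2)
    (by rwa [zero_add])
  · intro i l
    split_ifs with h
    · rw [abs_mul]
      exact mul_le_mul (hbB _ (by omega))
        ((Complex.abs_re_le_norm _).trans (norm_inner_le_norm _ _)) (abs_nonneg _) hB
    · rw [abs_zero]; positivity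
  · intro i hi l hl
    rw [if_pos (by omega), hb, zero_mul, sub_zero]

theorem re_inner_powDeriv₂_sum_nonneg {n m : ℕ} (hnm : 2 * n ≤ m) {s w : Fin n → ℝ}
    (hw : ∀ a, 1 ≤ w a) {κ : ℝ}
    (hκ : ∀ v : Fin n → E, κ * (∑ i, ‖v i‖) ^ 2 ≤ ∑ a, ‖∑ i : Fin n, s a ^ (i : ℕ) • v i‖ ^ 2)
    {b : ℕ → ℝ} (hb : ∀ k, b (k + 2) = ∑ a, w a * s a ^ k) {B ε η : ℝ} (hB : 0 ≤ B)
    (hbB : ∀ k ≤ m, |b k| ≤ B) {T D : E →L[ℂ] E} (hT : IsSelfAdjoint T) (hD : IsSelfAdjoint D)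
    (hε : ε ≤ 1) (hTε : ‖T‖ ≤ ε)
    {c : ℕ → ℂ} (hη : n * η ≤ 1) (hη0 : 0 ≤ η) (hc : ∀ j < n, ‖c j‖ ≤ η)
    (hTn : T ^ n = -∑ j ∈ Finset.range n, c j • T ^ j)
    (hsmall : ((m + 1 : ℕ) : ℝ) * B * ε +
      ((m + 1 : ℕ) : ℝ) ^ 2 * (((m + 1 : ℕ) : ℝ) * B * (n * η)) ≤ κ) (ξ : E) :
    0 ≤ ∑ k ∈ Finset.range (m + 1), b k * (inner ℂ ξ (powDeriv₂ T D k ξ)).re := by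
  rw [sum_re_inner_powDeriv₂ hT hD]
  have hε0 : 0 ≤ ε := (norm_nonneg T).trans hTε
  set v : ℕ → E := fun k => D ((T ^ k) ξ) with hvdef
  have hrec : ∀ k, v (k + n) = -∑ j ∈ Finset.range n, c j • v (k + j) := by
    intro k
    change D ((T ^ (k + n)) ξ) = -∑ j ∈ Finset.range n, c j • D ((T ^ (k + j)) ξ)
    simp [pow_add, hTn]
  have hv := norm_le_of_linear_recurrence hη hc hrec
  have hterm : ∀ i l j, |if i + j + l + 2 < m + 1 then b (i + j + l + 2) *
      (inner ℂ (v i) ((T ^ j) (v l))).re else 0| ≤ B * (ε ^ j * (‖v i‖ * ‖v l‖)) := by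
    intro i l j
    split_ifs with h
    · rw [abs_mul]
      refine mul_le_mul (hbB _ (by omega)) ?_ (abs_nonneg _) hB
      refine (Complex.abs_re_le_norm _).trans ((norm_inner_le_norm _ _).trans ?_)
      have : ‖(T ^ j) (v l)‖ ≤ ε ^ j * ‖v l‖ := by
        clear h
        induction j with
        | zero => simp
        | succ j ih =>
          rw [pow_succ', pow_succ', mul_assoc]
          exact (T.le_opNorm _).trans (mul_le_mul hTε ih (norm_nonneg _) hε0)
      calc _ ≤ ‖v i‖ * (ε ^ j * ‖v l‖) := by gcongr
        _ = _ := by ring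
    · rw [abs_zero]; positivity
  refine sum_form_nonneg (v := v) (by omega) hw hκ (B := ((m + 1 : ℕ) : ℝ) * B)
    (δ := ((m + 1 : ℕ) : ℝ) * B * ε)
    (η := n * η) (by positivity) (by positivity) ?_ ?_ (fun k => (hv k).1) (fun k => (hv k).2)
    hsmall
  · intro i l
    calc _ ≤ ∑ j ∈ Finset.range (m + 1), B * (‖v i‖ * ‖v l‖) := by
          refine (Finset.abs_sum_le_sum_abs _ _).trans (Finset.sum_le_sum fun j _ => ?_)
          refine (hterm i l j).trans ?_
          exact mul_le_mul_of_nonneg_left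
            (mul_le_of_le_one_left (by positivity) (pow_le_one₀ hε0 hε)) hB
      _ = _ := by simp [mul_assoc]
  · intro i hi l hl
    -- The term `j = 0` is the moment form; the terms `j ≥ 1` carry a factor `ε` and make up the
    -- error `δ`.
    rw [Finset.sum_range_succ', if_pos (by omega), add_zero, hb, pow_zero,
      one_apply_eq_self]
    have h1 : |∑ j ∈ Finset.range m, if i + (j + 1) + l + 2 < m + 1 then b (i + (j + 1) + l + 2) *
        (inner ℂ (v i) ((T ^ (j + 1)) (v l))).re else 0| ≤
        ((m + 1 : ℕ) : ℝ) * B * ε * (‖v i‖ * ‖v l‖) := by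
      calc _ ≤ ∑ j ∈ Finset.range m, B * (ε * (‖v i‖ * ‖v l‖)) := by
            refine (Finset.abs_sum_le_sum_abs _ _).trans (Finset.sum_le_sum fun j _ => ?_)
            refine (hterm i l (j + 1)).trans ?_
            gcongr
            rw [pow_succ]
            exact mul_le_of_le_one_left hε0 (pow_le_one₀ hε0 hε)
        _ = m * (B * (ε * (‖v i‖ * ‖v l‖))) := by simp
        _ ≤ (m + 1 : ℕ) * (B * (ε * (‖v i‖ * ‖v l‖))) := by gcongr; omega
        _ = _ := by ring
    have h2 := (abs_le.mp h1).1
    linarith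

end Form

/-! ### Monotonicity and convexity for operators of small norm. -/

section Operator

variable {E : Type*} [NormedAddCommGroup E] [InnerProductSpace ℂ E]

/-- Cayley–Hamilton. The eigenvalues are bounded by `ε`, so the coefficient of index `j < n` is at
most `ε ^ (n - j)` times a binomial coefficient; `ε ≤ 1` leaves one factor `ε`. -/
theorem exists_pow_finrank_eq_neg_sum [FiniteDimensional ℂ E] {T : E →L[ℂ] E} {ε : ℝ}
    (hT : ‖T‖ ≤ ε) (hε : ε ≤ 1) :
    ∃ c : ℕ → ℂ, (∀ j < Module.finrank ℂ E, ‖c j‖ ≤ ε * 2 ^ Module.finrank ℂ E) ∧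
      T ^ Module.finrank ℂ E = -∑ j ∈ Finset.range (Module.finrank ℂ E), c j • T ^ j := by
  set n := Module.finrank ℂ E with hn
  set f : E →ₗ[ℂ] E := T.toLinearMap with hf
  have hε0 : 0 ≤ ε := (norm_nonneg T).trans hT
  have hdeg : f.charpoly.natDegree = n := f.charpoly_natDegree
  have hmonic : f.charpoly.Monic := f.charpoly_monic
  refine ⟨fun j => f.charpoly.coeff j, fun j hj => ?_, ?_⟩
  · have hroot : ∀ z ∈ (Polynomial.map (RingHom.id ℂ) f.charpoly).roots, ‖z‖ ≤ ε := by
      intro z hz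
      rw [Polynomial.map_id, Polynomial.mem_roots hmonic.ne_zero,
        ← Module.End.hasEigenvalue_iff_isRoot_charpoly] at hz
      obtain ⟨x, hx⟩ := hz.exists_hasEigenvector
      have h1 : T x = z • x := hx.apply_eq_smul
      have h2 := T.le_of_opNorm_le hT x
      rw [h1, norm_smul] at h2
      exact le_of_mul_le_mul_right h2 (norm_pos_iff.mpr hx.2)
    have h := Polynomial.coeff_le_of_roots_le (f := RingHom.id ℂ) j hmonic
      (IsAlgClosed.splits _) hroot
    rw [Polynomial.map_id, hdeg] at h
    refine h.trans ?_
    refine mul_le_mul (pow_le_of_le_one hε0 hε (by omega)) ?_ (by positivity) hε0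
    exact_mod_cast Nat.choose_le_two_pow n j
  · have h := f.aeval_self_charpoly
    rw [Polynomial.aeval_eq_sum_range, hdeg, Finset.sum_range_succ, ← hdeg,
      hmonic.coeff_natDegree, one_smul, hdeg, add_comm] at h
    have h' := eq_neg_of_add_eq_zero_left h
    ext x
    have := LinearMap.congr_fun h' x
    simpa [Module.End.pow_apply, hf] using this

theorem hasDerivAt_sum_re_inner {F : ℝ → ℕ → E →L[ℂ] E} {F' : ℕ → E →L[ℂ] E} {t : ℝ}
    (hF : ∀ k, HasDerivAt (fun t => F t k) (F' k) t) (b : ℕ → ℝ) (N : ℕ) (ξ : E) :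
    HasDerivAt (fun t => ∑ k ∈ Finset.range N, b k * (inner ℂ ξ (F t k ξ)).re)
      (∑ k ∈ Finset.range N, b k * (inner ℂ ξ (F' k ξ)).re) t := by
  set L : (E →L[ℂ] E) →L[ℝ] ℝ := Complex.reCLM.comp
    (((innerSL ℂ ξ).comp (ContinuousLinearMap.apply ℂ E ξ)).restrictScalars ℝ)
  refine HasDerivAt.fun_sum fun k _ => HasDerivAt.const_mul _ ?_
  exact L.hasFDerivAt.comp_hasDerivAt t (hF k)

theorem norm_add_smul_sub_le {A B : E →L[ℂ] E} {ε : ℝ} (hA : ‖A‖ ≤ ε) (hB : ‖B‖ ≤ ε) {t : ℝ}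
    (ht : t ∈ Set.Icc (0 : ℝ) 1) : ‖A + t • (B - A)‖ ≤ ε := by
  have h : A + t • (B - A) = (1 - t) • A + t • B := by module
  rw [h]
  calc _ ≤ ‖(1 - t) • A‖ + ‖t • B‖ := norm_add_le _ _
    _ = (1 - t) * ‖A‖ + t * ‖B‖ := by
      rw [norm_smul, norm_smul, Real.norm_of_nonneg (by linarith [ht.2]),
        Real.norm_of_nonneg ht.1]
    _ ≤ (1 - t) * ε + t * ε := by
      have := ht.1; have := ht.2
      gcongr
    _ = ε := by ring

variable [CompleteSpace E]

theorem isSelfAdjoint_add_smul_sub {A B : E →L[ℂ] E} (hA : IsSelfAdjoint A)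
    (hB : IsSelfAdjoint B) (t : ℝ) : IsSelfAdjoint (A + t • (B - A)) :=
  hA.add ((IsSelfAdjoint.all t).smul (hB.sub hA))

theorem exists_pos_le_one_mul_le {a b κ : ℝ} (ha : 0 ≤ a) (hb : 0 ≤ b) (hκ : 0 < κ) :
    ∃ ε : ℝ, 0 < ε ∧ ε ≤ 1 ∧ a * ε ≤ 1 ∧ b * ε ≤ κ := by
  refine ⟨min 1 (min (a + 1)⁻¹ (κ / (b + 1))), by positivity, min_le_left _ _, ?_, ?_⟩
  · calc _ ≤ a * (a + 1)⁻¹ := by gcongr; exact (min_le_right _ _).trans (min_le_left _ _)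
      _ ≤ 1 := by rw [mul_inv_le_iff₀ (by positivity)]; linarith
  · calc _ ≤ b * (κ / (b + 1)) := by gcongr; exact (min_le_right _ _).trans (min_le_right _ _)
      _ ≤ κ := by rw [mul_div_assoc', div_le_iff₀ (by positivity)]; nlinarith

theorem abs_le_sum_range_abs (b : ℕ → ℝ) {m k : ℕ} (hk : k ≤ m) :
    |b k| ≤ ∑ j ∈ Finset.range (m + 1), |b j| :=
  Finset.single_le_sum (f := fun j => |b j|) (fun _ _ => abs_nonneg _)
    (Finset.mem_range.mpr (by omega))

variable [FiniteDimensional ℂ E]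

theorem exists_re_inner_sum_pow_le {n m : ℕ} (hE : Module.finrank ℂ E = n) (hnm : 2 * n ≤ m)
    {s w : Fin n → ℝ} (hs : Function.Injective s) (hw : ∀ a, 1 ≤ w a)
    {b : ℕ → ℝ} (hb : ∀ k, b (k + 1) = ∑ a, w a * s a ^ k) :
    ∃ ε : ℝ, 0 < ε ∧ ∀ A B : E →L[ℂ] E, IsSelfAdjoint A → IsSelfAdjoint B → ‖A‖ ≤ ε → ‖B‖ ≤ ε →
      ∀ C : E →L[ℂ] E, B - A = ContinuousLinearMap.adjoint C * C → ∀ ξ : E,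
      ∑ k ∈ Finset.range (m + 1), b k * (inner ℂ ξ ((A ^ k) ξ)).re ≤
        ∑ k ∈ Finset.range (m + 1), b k * (inner ℂ ξ ((B ^ k) ξ)).re := by
  subst hE
  set n := Module.finrank ℂ E
  obtain ⟨κ, hκ0, hκ⟩ := exists_sq_sum_norm_le_vandermonde E hs
  set M := ∑ j ∈ Finset.range (m + 1), |b j|
  have hM : 0 ≤ M := by positivity
  -- The two constants give `n * η ≤ 1` and the smallness condition for `η = ε * 2 ^ n`.
  obtain ⟨ε, hε0, hε1, h1, h2⟩ := exists_pos_le_one_mul_le (a := n * 2 ^ n)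
    (b := ((m + 1 : ℕ) : ℝ) ^ 2 * (M * (n * 2 ^ n))) (by positivity) (by positivity) hκ0
  refine ⟨ε, hε0, fun A B hA hB hAε hBε C hC ξ => ?_⟩
  set g : ℝ → ℝ := fun t => ∑ k ∈ Finset.range (m + 1),
    b k * (inner ℂ ξ (((A + t • (B - A)) ^ k) ξ)).re
  have hg : ∀ t, HasDerivAt g (∑ k ∈ Finset.range (m + 1),
      b k * (inner ℂ ξ (powDeriv (A + t • (B - A)) (B - A) k ξ)).re) t := fun t =>
    hasDerivAt_sum_re_inner (fun k => hasDerivAt_add_smul_pow A (B - A) k t) b (m + 1) ξ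
  have hmono : MonotoneOn g (Set.Icc 0 1) := by
    refine monotoneOn_of_hasDerivWithinAt_nonneg (convex_Icc 0 1)
      (fun t _ => (hg t).continuousAt.continuousWithinAt) (fun t _ => (hg t).hasDerivWithinAt)
      fun t ht => ?_
    obtain ⟨c, hc, hTn⟩ := exists_pow_finrank_eq_neg_sum
      (norm_add_smul_sub_le hAε hBε (interior_subset ht)) hε1
    rw [hC]
    exact re_inner_powDeriv_sum_nonneg hnm hw hκ hb hM (fun k hk => abs_le_sum_range_abs b hk)
      (hC ▸ isSelfAdjoint_add_smul_sub hA hB t) C (by linarith) (by positivity) hc (hC ▸ hTn)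
      (by linarith) ξ
  simpa [g] using hmono (Set.left_mem_Icc.mpr zero_le_one) (Set.right_mem_Icc.mpr zero_le_one)
    zero_le_one

theorem exists_re_inner_sum_pow_convex {n m : ℕ} (hE : Module.finrank ℂ E = n) (hnm : 2 * n ≤ m)
    {s w : Fin n → ℝ} (hs : Function.Injective s) (hw : ∀ a, 1 ≤ w a)
    {b : ℕ → ℝ} (hb : ∀ k, b (k + 2) = ∑ a, w a * s a ^ k) :
    ∃ ε : ℝ, 0 < ε ∧ ∀ A B : E →L[ℂ] E, IsSelfAdjoint A → IsSelfAdjoint B → ‖A‖ ≤ ε → ‖B‖ ≤ ε →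
      ∀ c ∈ Set.Icc (0 : ℝ) 1, ∀ ξ : E,
      ∑ k ∈ Finset.range (m + 1), b k * (inner ℂ ξ (((c • A + (1 - c) • B) ^ k) ξ)).re ≤
        c * ∑ k ∈ Finset.range (m + 1), b k * (inner ℂ ξ ((A ^ k) ξ)).re +
        (1 - c) * ∑ k ∈ Finset.range (m + 1), b k * (inner ℂ ξ ((B ^ k) ξ)).re := by
  subst hE
  set n := Module.finrank ℂ E
  obtain ⟨κ, hκ0, hκ⟩ := exists_sq_sum_norm_le_vandermonde E hs
  set M := ∑ j ∈ Finset.range (m + 1), |b j|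
  have hM : 0 ≤ M := by positivity
  obtain ⟨ε, hε0, hε1, h1, h2⟩ := exists_pos_le_one_mul_le (a := n * 2 ^ n)
    (b := ((m + 1 : ℕ) : ℝ) * M + ((m + 1 : ℕ) : ℝ) ^ 2 * (((m + 1 : ℕ) : ℝ) * M * (n * 2 ^ n)))
    (by positivity) (by positivity) hκ0
  refine ⟨ε, hε0, fun A B hA hB hAε hBε c hc ξ => ?_⟩
  set g : ℝ → ℝ := fun t => ∑ k ∈ Finset.range (m + 1),
    b k * (inner ℂ ξ (((B + t • (A - B)) ^ k) ξ)).re with hgdef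
  have hg : ∀ t, HasDerivAt g (∑ k ∈ Finset.range (m + 1),
      b k * (inner ℂ ξ (powDeriv (B + t • (A - B)) (A - B) k ξ)).re) t := fun t =>
    hasDerivAt_sum_re_inner (fun k => hasDerivAt_add_smul_pow B (A - B) k t) b (m + 1) ξ
  have hg' : ∀ t, HasDerivAt (fun t => ∑ k ∈ Finset.range (m + 1),
      b k * (inner ℂ ξ (powDeriv (B + t • (A - B)) (A - B) k ξ)).re)
      (∑ k ∈ Finset.range (m + 1),
        b k * (inner ℂ ξ (((2 : ℝ) • powDeriv₂ (B + t • (A - B)) (A - B) k) ξ)).re) t := fun t =>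
    hasDerivAt_sum_re_inner (fun k => hasDerivAt_powDeriv B (A - B) k t) b (m + 1) ξ
  have hconv : ConvexOn ℝ (Set.Icc 0 1) g := by
    refine convexOn_of_hasDerivWithinAt2_nonneg (convex_Icc 0 1)
      (fun t _ => (hg t).continuousAt.continuousWithinAt) (fun t _ => (hg t).hasDerivWithinAt)
      (fun t _ => (hg' t).hasDerivWithinAt) fun t ht => ?_
    have hT := norm_add_smul_sub_le hBε hAε (interior_subset ht)
    obtain ⟨c, hc, hTn⟩ := exists_pow_finrank_eq_neg_sum hT hε1
    have h := re_inner_powDeriv₂_sum_nonneg hnm hw hκ hb hM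
      (fun k hk => abs_le_sum_range_abs b hk)
      (isSelfAdjoint_add_smul_sub hB hA t) (hA.sub hB) hε1 hT
      (by linarith) (by positivity) hc hTn (by linarith) ξ
    have h2 : ∀ X : E →L[ℂ] E, (inner ℂ ξ (((2 : ℝ) • X) ξ)).re = 2 * (inner ℂ ξ (X ξ)).re := by
      intro X
      simp [two_smul, two_mul]
    simp only [h2, mul_left_comm _ (2 : ℝ), ← Finset.mul_sum]
    positivity
  have h := hconv.2 (Set.right_mem_Icc.mpr zero_le_one) (Set.left_mem_Icc.mpr zero_le_one)
    hc.1 (sub_nonneg.mpr hc.2) (by ring)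
  have hseg : B + c • (A - B) = c • A + (1 - c) • B := by module
  simp only [smul_eq_mul, mul_one, mul_zero, add_zero, hgdef, hseg, one_smul, zero_smul,
    add_sub_cancel] at h
  exact h

end Operator

/-! ### From operators to matrices and the functional calculus. -/

section MatrixTransfer

open scoped MatrixOrder

variable {n : ℕ}

theorem norm_toEuclideanCLM_le {A : Matrix (Fin n) (Fin n) ℂ} (hA : A.IsHermitian) {R : ℝ}
    (hR0 : 0 ≤ R) (hR : ∀ x ∈ spectrum ℝ A, |x| ≤ R) :
    ‖Matrix.toEuclideanCLM (n := Fin n) (𝕜 := ℂ) A‖ ≤ R := by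
  set φ := Matrix.toEuclideanCLM (n := Fin n) (𝕜 := ℂ)
  have hsa : IsSelfAdjoint (φ A) := hA.isSelfAdjoint.map φ
  have hspec : spectrum ℝ (φ A) = spectrum ℝ A :=
    AlgEquiv.spectrum_eq (φ.toAlgEquiv.restrictScalars ℝ) A
  rw [← cfc_id ℝ (φ A)]
  refine norm_cfc_le hR0 fun x hx => ?_
  rw [hspec] at hx
  exact hR x hx

theorem posSemidef_of_re_inner_nonneg {M : Matrix (Fin n) (Fin n) ℂ} (hM : M.IsHermitian)
    (h : ∀ ξ, 0 ≤ (inner ℂ ξ (Matrix.toEuclideanCLM (n := Fin n) (𝕜 := ℂ) M ξ)).re) :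
    M.PosSemidef := by
  rw [← Matrix.isPositive_toEuclideanLin_iff]
  refine ⟨Matrix.isSymmetric_toEuclideanLin_iff.mpr hM, fun ξ => ?_⟩
  rw [inner_re_symm]
  exact h ξ

/-- The polynomial `∑_{k ≤ m} b k (δ X)^k`. -/
noncomputable def scaledPoly (b : ℕ → ℝ) (m : ℕ) (δ : ℝ) : Polynomial ℝ :=
  ∑ k ∈ Finset.range (m + 1), Polynomial.monomial k (b k * δ ^ k)

theorem scaledPoly_smul (σ : ℝ) (b : ℕ → ℝ) (m : ℕ) (δ : ℝ) :
    scaledPoly (fun k => σ * b k) m δ = σ • scaledPoly b m δ := by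
  simp [scaledPoly, Finset.smul_sum, Polynomial.smul_monomial, mul_assoc]

theorem coeff_scaledPoly (b : ℕ → ℝ) (m : ℕ) (δ : ℝ) (k : ℕ) :
    (scaledPoly b m δ).coeff k = if k ≤ m then b k * δ ^ k else 0 := by
  simp [scaledPoly, Polynomial.coeff_monomial]

theorem eval_scaledPoly (b : ℕ → ℝ) (m : ℕ) (δ t : ℝ) :
    (scaledPoly b m δ).eval t = (scaledPoly b m 1).eval (δ * t) := by
  simp [scaledPoly, Polynomial.eval_finsetSum, mul_pow, mul_assoc]

theorem degree_scaledPoly {b : ℕ → ℝ} {m : ℕ} {δ : ℝ} (hb : b m ≠ 0) (hδ : δ ≠ 0) :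
    (scaledPoly b m δ).degree = m := by
  refine le_antisymm ((Polynomial.degree_le_iff_coeff_zero _ _).mpr fun k hk => ?_)
    (Polynomial.le_degree_of_ne_zero ?_)
  · rw [coeff_scaledPoly, if_neg (not_le.mpr (by exact_mod_cast hk))]
  · rw [coeff_scaledPoly, if_pos le_rfl]
    positivity

theorem re_inner_cfc_scaledPoly (b : ℕ → ℝ) (m : ℕ) (δ : ℝ) {A : Matrix (Fin n) (Fin n) ℂ}
    (hA : A.IsHermitian) (ξ : EuclideanSpace ℂ (Fin n)) :
    (inner ℂ ξ (Matrix.toEuclideanCLM (n := Fin n) (𝕜 := ℂ)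
      (cfc (fun t => (scaledPoly b m δ).eval t) A) ξ)).re =
    ∑ k ∈ Finset.range (m + 1), b k *
      (inner ℂ ξ ((Matrix.toEuclideanCLM (n := Fin n) (𝕜 := ℂ) (δ • A) ^ k) ξ)).re := by
  set φ := Matrix.toEuclideanCLM (n := Fin n) (𝕜 := ℂ)
  have hφ : ∀ (r : ℝ) (X : Matrix (Fin n) (Fin n) ℂ), φ (r • X) = r • φ X :=
    map_smul (φ.toAlgEquiv.restrictScalars ℝ)
  rw [cfc_polynomial _ A hA.isSelfAdjoint, scaledPoly]
  simp only [map_sum, Polynomial.aeval_monomial, ← Algebra.smul_def, sum_apply,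
    inner_sum, Complex.re_sum]
  refine Finset.sum_congr rfl fun k _ => ?_
  have h : ∀ (r : ℝ) (X : EuclideanSpace ℂ (Fin n) →L[ℂ] EuclideanSpace ℂ (Fin n)),
      (inner ℂ ξ ((r • X) ξ)).re = r * (inner ℂ ξ (X ξ)).re := by
    intro r X
    rw [smul_apply, ← Complex.coe_smul, inner_smul_right,
      Complex.re_ofReal_mul]
  rw [← map_pow φ (δ • A) k, smul_pow, hφ, hφ, h, h, mul_assoc]

theorem exists_nMonotoneOn_scaledPoly {m : ℕ} (hnm : 2 * n ≤ m)
    {s w : Fin n → ℝ} (hs : Function.Injective s) (hw : ∀ a, 1 ≤ w a)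
    {b : ℕ → ℝ} (hb : ∀ k, b (k + 1) = ∑ a, w a * s a ^ k) :
    ∃ ε : ℝ, 0 < ε ∧ ∀ (I : Set ℝ) (R δ : ℝ), (∀ x ∈ I, |x| ≤ R) → 0 ≤ R → 0 < δ → δ * R ≤ ε →
      NMonotoneOn n (fun t => (scaledPoly b m δ).eval t) I := by
  obtain ⟨ε, hε, key⟩ := exists_re_inner_sum_pow_le (E := EuclideanSpace ℂ (Fin n))
    finrank_euclideanSpace_fin hnm hs hw hb
  refine ⟨ε, hε, fun I R δ hI hR hδ hδR A B hA hB hAI hBI hAB => ?_⟩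
  set φ := Matrix.toEuclideanCLM (n := Fin n) (𝕜 := ℂ)
  have hnorm : ∀ X : Matrix (Fin n) (Fin n) ℂ, X.IsHermitian → spectrum ℝ X ⊆ I →
      ‖φ (δ • X)‖ ≤ ε := by
    intro X hX hXI
    rw [show φ (δ • X) = δ • φ X from map_smul (φ.toAlgEquiv.restrictScalars ℝ) δ X, norm_smul,
      Real.norm_of_nonneg hδ.le]
    exact (mul_le_mul_of_nonneg_left
      (norm_toEuclideanCLM_le hX hR fun x hx => hI x (hXI hx)) hδ.le).trans hδR
  have hsa : ∀ X : Matrix (Fin n) (Fin n) ℂ, X.IsHermitian → IsSelfAdjoint (φ (δ • X)) :=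
    fun X hX => ((IsSelfAdjoint.all δ).smul hX.isSelfAdjoint).map φ
  -- Writing the direction as `C* C` lets the derivative be expressed through the vectors `C T ^ k
  -- ξ`.
  obtain ⟨C, hC⟩ := CStarAlgebra.nonneg_iff_eq_star_mul_self.mp (hAB.smul hδ.le).nonneg
  have hD : φ (δ • B) - φ (δ • A) = ContinuousLinearMap.adjoint (φ C) * φ C := by
    rw [← map_sub, ← smul_sub, hC, map_mul, map_star,
      ContinuousLinearMap.star_eq_adjoint]
  refine posSemidef_of_re_inner_nonneg
    ((cfc_predicate (R := ℝ) _ B).sub (cfc_predicate (R := ℝ) _ A)) fun ξ => ?_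
  rw [map_sub, sub_apply, inner_sub_right, Complex.sub_re,
    re_inner_cfc_scaledPoly b m δ hA, re_inner_cfc_scaledPoly b m δ hB, sub_nonneg]
  exact key _ _ (hsa A hA) (hsa B hB) (hnorm A hA hAI) (hnorm B hB hBI) _ hD ξ

theorem exists_nConvexOn_scaledPoly {m : ℕ} (hnm : 2 * n ≤ m)
    {s w : Fin n → ℝ} (hs : Function.Injective s) (hw : ∀ a, 1 ≤ w a)
    {b : ℕ → ℝ} (hb : ∀ k, b (k + 2) = ∑ a, w a * s a ^ k) :
    ∃ ε : ℝ, 0 < ε ∧ ∀ (I : Set ℝ) (R δ : ℝ), (∀ x ∈ I, |x| ≤ R) → 0 ≤ R → 0 < δ → δ * R ≤ ε →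
      NConvexOn n (fun t => (scaledPoly b m δ).eval t) I := by
  obtain ⟨ε, hε, key⟩ := exists_re_inner_sum_pow_convex (E := EuclideanSpace ℂ (Fin n))
    finrank_euclideanSpace_fin hnm hs hw hb
  refine ⟨ε, hε, fun I R δ hI hR hδ hδR A B hA hB hAI hBI c hc => ?_⟩
  set φ := Matrix.toEuclideanCLM (n := Fin n) (𝕜 := ℂ)
  have hnorm : ∀ X : Matrix (Fin n) (Fin n) ℂ, X.IsHermitian → spectrum ℝ X ⊆ I →
      ‖φ (δ • X)‖ ≤ ε := by
    intro X hX hXI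
    rw [show φ (δ • X) = δ • φ X from map_smul (φ.toAlgEquiv.restrictScalars ℝ) δ X, norm_smul,
      Real.norm_of_nonneg hδ.le]
    exact (mul_le_mul_of_nonneg_left
      (norm_toEuclideanCLM_le hX hR fun x hx => hI x (hXI hx)) hδ.le).trans hδR
  have hsa : ∀ X : Matrix (Fin n) (Fin n) ℂ, X.IsHermitian → IsSelfAdjoint (φ (δ • X)) :=
    fun X hX => ((IsSelfAdjoint.all δ).smul hX.isSelfAdjoint).map φ
  have hφ : ∀ (r : ℝ) X, φ (r • X) = r • φ X := map_smul (φ.toAlgEquiv.restrictScalars ℝ)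
  have hAB : (c • A + (1 - c) • B).IsHermitian :=
    ((IsSelfAdjoint.all c).smul hA.isSelfAdjoint).add
      ((IsSelfAdjoint.all (1 - c)).smul hB.isSelfAdjoint)
  refine posSemidef_of_re_inner_nonneg
    ((((IsSelfAdjoint.all c).smul (cfc_predicate (R := ℝ) _ A)).add
      ((IsSelfAdjoint.all (1 - c)).smul (cfc_predicate (R := ℝ) _ B))).sub
      (cfc_predicate (R := ℝ) _ _)) fun ξ => ?_
  rw [map_sub, map_add, hφ, hφ, sub_apply, add_apply,
    smul_apply, smul_apply, inner_sub_right,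
    inner_add_right, ← Complex.coe_smul, ← Complex.coe_smul, inner_smul_right, inner_smul_right,
    Complex.sub_re, Complex.add_re, Complex.re_ofReal_mul, Complex.re_ofReal_mul,
    re_inner_cfc_scaledPoly b m δ hA, re_inner_cfc_scaledPoly b m δ hB,
    re_inner_cfc_scaledPoly b m δ hAB, sub_nonneg, smul_add, smul_comm δ c,
    smul_comm δ (1 - c), map_add, hφ c, hφ (1 - c)]
  exact key _ _ (hsa A hA) (hsa B hB) (hnorm A hA hAI) (hnorm B hB hBI) c hc ξ

end MatrixTransfer

/-! ### Positivity of the Hankel determinants. -/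

section Hankel

variable {n : ℕ}

theorem iteratedDeriv_eval_zero (p : Polynomial ℝ) (k : ℕ) :
    iteratedDeriv k (fun t => p.eval t) 0 = (k.factorial : ℝ) * p.coeff k := by
  have h : ∀ k, iteratedDeriv k (fun t => p.eval t) =
      fun t => (Polynomial.derivative^[k] p).eval t := by
    intro k
    induction k with
    | zero => simp
    | succ k ih =>
      rw [iteratedDeriv_succ, ih]
      funext t
      rw [Polynomial.deriv, Function.iterate_succ_apply']
  rw [h]
  simp only [← Polynomial.coeff_zero_eq_eval_zero, Polynomial.coeff_iterate_derivative, zero_add,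
    Nat.descFactorial_self, nsmul_eq_mul]

theorem contDiff_eval (p : Polynomial ℝ) {k : WithTop ℕ∞} :
    ContDiff ℝ k (fun t => p.eval t) := by
  simpa using p.contDiff_aeval (𝕜 := ℝ) k

theorem det_moment_pos {s w : Fin n → ℝ} (hs : Function.Injective s) (hw : ∀ a, 0 < w a) :
    0 < (Matrix.of fun i j : Fin n => ∑ a, w a * s a ^ ((i : ℕ) + j)).det := by
  have h : (Matrix.of fun i j : Fin n => ∑ a, w a * s a ^ ((i : ℕ) + j)) =
      (Matrix.vandermonde s).transpose * (Matrix.diagonal w * Matrix.vandermonde s) := by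
    ext i j
    rw [Matrix.mul_apply]
    simp only [Matrix.diagonal_mul, Matrix.transpose_apply,
      Matrix.vandermonde_apply, Matrix.of_apply]
    exact Finset.sum_congr rfl fun a _ => by ring
  rw [h, Matrix.det_mul, Matrix.det_mul, Matrix.det_transpose, Matrix.det_diagonal]
  have h1 : 0 < ∏ a, w a := Finset.prod_pos fun a _ => hw a
  have h2 := Matrix.det_vandermonde_ne_zero_iff.mpr hs
  have h3 : 0 < (Matrix.vandermonde s).det ^ 2 := by positivity
  nlinarith [mul_pos h1 h3]

/-- Used with `r = 1` for monotonicity and `r = 2` for convexity; `hr` says that the largest index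
`2 * n - 2 + r` is at most `m`. -/
theorem exists_det_hankel_scaledPoly_pos {m r : ℕ} (hr : 2 * n + r ≤ m + 2)
    {s w : Fin n → ℝ} (hs : Function.Injective s) (hw : ∀ a, 1 ≤ w a)
    {b : ℕ → ℝ} (hb : ∀ k, b (k + r) = ∑ a, w a * s a ^ k) :
    ∃ ε : ℝ, 0 < ε ∧ ∀ (I : Set ℝ) (R δ : ℝ), UniqueDiffOn ℝ I → (∀ x ∈ I, |x| ≤ R) → 0 < δ →
      δ * R ≤ ε → ∀ t ∈ I, 0 < (Matrix.of fun i j : Fin n =>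
        iteratedDerivWithin ((i : ℕ) + j + r) (fun t => (scaledPoly b m δ).eval t) I t /
          (Nat.factorial ((i : ℕ) + j + r) : ℝ)).det := by
  set M : ℝ → Matrix (Fin n) (Fin n) ℝ := fun x => Matrix.of fun i j : Fin n =>
    iteratedDeriv ((i : ℕ) + j + r) (fun t => (scaledPoly b m 1).eval t) x /
      (Nat.factorial ((i : ℕ) + j + r) : ℝ) with hM
  have hcont : Continuous fun x => (M x).det := by
    refine Continuous.matrix_det (continuous_matrix fun i j => ?_)
    exact ((contDiff_eval _).continuous_iteratedDeriv _ le_rfl).div_const _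
  have h0 : 0 < (M 0).det := by
    convert det_moment_pos hs (fun a => zero_lt_one.trans_le (hw a)) using 2
    ext i j
    simp only [hM, Matrix.of_apply]
    rw [iteratedDeriv_eval_zero, mul_div_cancel_left₀ _ (by positivity), coeff_scaledPoly,
      if_pos (by omega), one_pow, mul_one, hb]
  obtain ⟨ε, hε, hball⟩ := Metric.eventually_nhds_iff.mp
    (hcont.continuousAt.eventually (lt_mem_nhds h0))
  refine ⟨ε / 2, by positivity, fun I R δ hI hR hδ hδR t ht => ?_⟩
  have hpos : 0 < (M (δ * t)).det := by
    refine hball ?_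
    rw [dist_zero_right, Real.norm_eq_abs, abs_mul, abs_of_pos hδ]
    have := mul_le_mul_of_nonneg_left (hR t ht) hδ.le
    linarith
  have hentry : (Matrix.of fun i j : Fin n =>
        iteratedDerivWithin ((i : ℕ) + j + r) (fun t => (scaledPoly b m δ).eval t) I t /
          (Nat.factorial ((i : ℕ) + j + r) : ℝ)) =
      Matrix.of fun i j : Fin n => δ ^ ((i : ℕ) + r) *
        (Matrix.of fun i j : Fin n => δ ^ (j : ℕ) * M (δ * t) i j) i j := by
    -- The chain rule gives `δ ^ (i + j + r)`, which splits into a row factor and a column factor,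
    -- both positive.
    ext i j
    simp only [Matrix.of_apply, hM]
    rw [iteratedDerivWithin_eq_iteratedDeriv hI (contDiff_eval _).contDiffAt ht]
    simp only [eval_scaledPoly b m δ]
    rw [iteratedDeriv_comp_const_mul (contDiff_eval _)]
    ring
  rw [hentry, Matrix.det_mul_column, Matrix.det_mul_row]
  positivity

end Hankel

/-! ### Choice of the moments and conclusion. -/

section Main

theorem uniqueDiffOn_of_ordConnected {I : Set ℝ} (hI : I.OrdConnected) (hnt : I.Nontrivial) :
    UniqueDiffOn ℝ I := by
  obtain ⟨x, hx, y, hy, hxy⟩ := hnt.exists_lt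
  refine uniqueDiffOn_convex hI.convex ⟨(x + y) / 2, ?_⟩
  exact interior_mono (hI.out hx hy) (by rw [interior_Icc]; constructor <;> linarith)

theorem exists_strictNConvexOn_strictNMonotoneOn {I : Set ℝ} (hI : I.OrdConnected)
    (hbdd : Bornology.IsBounded I) (hnt : I.Nontrivial) {m n : ℕ} (hn : 1 ≤ n) (hmn : 2 * n ≤ m)
    {σ : ℝ} (hσ : σ * σ = 1) :
    ∃ f : Polynomial ℝ, f.degree = (m : WithBot ℕ) ∧
      StrictNConvexOn n (fun t => σ * f.eval t) I ∧ StrictNMonotoneOn n (fun t => f.eval t) I := by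
  have hσ0 : σ ≠ 0 := by rintro rfl; simp at hσ
  -- The nodes have the sign of `σ`, so the weights `w a = σ * s a` of the shifted moments are at
  -- least `1`.
  set s : Fin n → ℝ := fun a => σ * ((a : ℕ) + 1) with hs_def
  set w : Fin n → ℝ := fun a => (a : ℕ) + 1 with hw_def
  have hs : Function.Injective s := by
    intro a a' h
    have h2 := mul_left_cancel₀ hσ0 h
    exact Fin.ext (by exact_mod_cast add_right_cancel h2)
  have hw : ∀ a, 1 ≤ w a := fun a => by simp [hw_def]
  -- Truncated subtraction makes `b 0 = n`; the constant term plays no role in the derivatives.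
  set b : ℕ → ℝ := fun k => ∑ a, s a ^ (k - 1) with hb_def
  have hb1 : ∀ k, b (k + 1) = ∑ a, (1 : ℝ) * s a ^ k := fun k => by simp [hb_def]
  have hb2 : ∀ k, (fun k => σ * b k) (k + 2) = ∑ a, w a * s a ^ k := by
    intro k
    simp only [hb_def, Finset.mul_sum, show k + 2 - 1 = k + 1 by omega]
    refine Finset.sum_congr rfl fun a _ => ?_
    rw [pow_succ, show σ * (s a ^ k * s a) = σ * σ * w a * s a ^ k by simp [hs_def, hw_def]; ring,
      hσ, one_mul]
  -- All nodes have the same sign, so no cancellation occurs; `1 ≤ n` makes the sum nonempty.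
  have hbm : b m ≠ 0 := by
    have : b m = σ ^ (m - 1) * ∑ a, w a ^ (m - 1) := by
      simp only [hb_def, hs_def, hw_def, mul_pow, Finset.mul_sum]
    rw [this]
    refine mul_ne_zero (pow_ne_zero _ hσ0) (ne_of_gt ?_)
    exact Finset.sum_pos (fun a _ => pow_pos (zero_lt_one.trans_le (hw a)) _)
      ⟨⟨0, hn⟩, Finset.mem_univ _⟩
  obtain ⟨ε₁, hε₁, h1⟩ := exists_nMonotoneOn_scaledPoly hmn hs (fun _ => le_rfl) hb1
  obtain ⟨ε₂, hε₂, h2⟩ := exists_nConvexOn_scaledPoly hmn hs hw (b := fun k => σ * b k) hb2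
  obtain ⟨ε₃, hε₃, h3⟩ := exists_det_hankel_scaledPoly_pos (m := m) (by omega) hs
    (fun _ => le_rfl) hb1
  obtain ⟨ε₄, hε₄, h4⟩ := exists_det_hankel_scaledPoly_pos (m := m) (by omega) hs hw
    (b := fun k => σ * b k) hb2
  obtain ⟨R, hR0, hR⟩ := hbdd.exists_pos_norm_le
  set ε := min (min ε₁ ε₂) (min ε₃ ε₄)
  have hε : 0 < ε := by positivity
  have hδR : ε / R * R = ε := div_mul_cancel₀ _ hR0.ne'
  have hδ : 0 < ε / R := by positivity
  have hU := uniqueDiffOn_of_ordConnected hI hnt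
  have hσf : (fun t => σ * (scaledPoly b m (ε / R)).eval t) =
      fun t => (scaledPoly (fun k => σ * b k) m (ε / R)).eval t := by
    simp [scaledPoly_smul]
  refine ⟨scaledPoly b m (ε / R), degree_scaledPoly hbm hδ.ne', ?_, ?_⟩
  · rw [hσf]
    exact ⟨h2 I R _ hR hR0.le hδ
        (hδR.trans_le ((min_le_left _ _).trans (min_le_right _ _))),
      (contDiff_eval _).contDiffOn, h4 I R _ hU hR hδ
        (hδR.trans_le ((min_le_right _ _).trans (min_le_right _ _)))⟩
  · exact ⟨h1 I R _ hR hR0.le hδ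
        (hδR.trans_le ((min_le_left _ _).trans (min_le_left _ _))),
      (contDiff_eval _).contDiffOn, h3 I R _ hU hR hδ
        (hδR.trans_le ((min_le_right _ _).trans (min_le_left _ _)))⟩

end Main

theorem mainTheorem1 (I : Set ℝ) (hI : I.OrdConnected) (hbdd : Bornology.IsBounded I)
    (hnt : I.Nontrivial) (m n : ℕ) (hn : 1 ≤ n) (hmn : 2 * n ≤ m) :
    (∃ f : Polynomial ℝ, f.degree = (m : WithBot ℕ) ∧
      StrictNConcaveOn n (fun t => f.eval t) I ∧ StrictNMonotoneOn n (fun t => f.eval t) I) ∧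
    (∃ g : Polynomial ℝ, g.degree = (m : WithBot ℕ) ∧
      StrictNConvexOn n (fun t => g.eval t) I ∧ StrictNMonotoneOn n (fun t => g.eval t) I) := by
  constructor
  · simpa [StrictNConcaveOn] using
      exists_strictNConvexOn_strictNMonotoneOn hI hbdd hnt hn hmn (σ := -1) (by norm_num)
  · simpa using
      exists_strictNConvexOn_strictNMonotoneOn hI hbdd hnt hn hmn (σ := 1) (by norm_num)
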